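/- **Conventions.** A copy-discard category is a symmetric monoidal category in which every object $X$ carries a commutative comonoid $(\nu_X\colon X\to X\otimes X,\ \varepsilon_X\colon X\to I)$ such that $\nu_{X\otimes Y}$, $\varepsilon_{X\otimes Y}$ are the tensors of those of $X$ and $Y$ and $\nu_I=\mathrm{id}_I$, $\varepsilon_I=\mathrm{id}_I$ (up to the coherence isomorphisms, which are suppressed here). Composition is written in diagrammatic order. A morphism $f\colon X\to Y$ is *total* if $f;\varepsilon_Y=\varepsilon_X$ and *deterministic* if $f;\nu_Y=\nu_X;(f\otimes f)$. For $f\colon X\to A$ and $g\colon X\otimes A\to B$, the conditional composition $f\triangleleft g\colon X\to A\otimes B$ is $\varphi(f);\varphi(g);\pi_2$, where $\varphi(f)=\nu_X;(\mathrm{id}_X\otimes f)$ and $\pi_2\colon X\otimes A\otimes B\to A\otimes B$ discards $X$. A *Markov category* is a copy-discard category $\mathbb C$ in which all morphisms are total and which has conditionals: for every $f\colon X\to Y\otimes Z$ there is $c\colon X\otimes Y\to Z$ with $f=(f;(\mathrm{id}_Y\otimes\varepsilon_Z))\triangleleft c$. For a Markov category $\mathbb C$, the category $\mathsf{exact}(\mathbb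 C)$ of processes with exact observations is the copy-discard category with the same objects obtained from $\mathbb C$ by freely adding a generator $x^\circ\colon X\to I$ for every deterministic $x\colon I\to X$ of $\mathbb C$ and quotienting by $(x\otimes y)^\circ=x^\circ\otimes y^\circ$, $\mathrm{id}_I^\circ=\mathrm{id}_I$ and $x^\circ\triangleleft\mathrm{id}_X=x^\circ;x$. A *normalisation* of a morphism $f\colon X\to Y$ is a morphism $n\colon X\to Y$ with $f=(f;\varepsilon_Y)\triangleleft n$. Two morphisms $g_1,g_2\colon X\otimes A\to B$ are $f$-almost surely equal, for $f\colon X\to A$, if $f\triangleleft g_1=f\triangleleft g_2$. **Theorem 5.3.** Let $\mathbb C$ be a Markov category and let $f\colon X\to Y$ be a morphism of $\mathsf{exact}(\mathbb C)$. Then there are an object $Z$, morphisms $h\colon X\to Z$ and $g\colon X\to Y$ of $\mathbb C$ and a deterministic state $z\colon I\to Z$ of $\mathbb C$ such that, in $\mathsf{exact}(\mathbb C)$, $$f=(h;z^\circ)\triangleleft g ,$$ where $h$ and $g$ are total in $\mathsf{exact}(\mathbb C)$ and $z$ is total. Moreover, whenever $f=(h;z^\circ)\triangleleft g$ with $h$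 and $g$ total morphisms of $\mathsf{exact}(\mathbb C)$ and $z$ a total and deterministic state of $\mathbb C$, the morphism $g$ is almost surely the normalisation of $f$: it is a normalisation of $f$, and every normalisation $n$ of $f$ is $(f;\varepsilon_Y)$-almost surely equal to $g$. -/

import Mathlib

open CategoryTheory MonoidalCategory ComonObj

universe v u

/-! ## Copy-discard categories: total and deterministic morphisms, conditionals, normalisations -/

namespace CopyDiscard

section General

variable {C : Type u} [Category.{v} C] [MonoidalCategory C] [CopyDiscardCategory C]

/-- A morphism is total if it can be discarded. -/
def IsTotal {X Y : C} (f : X ⟶ Y) : Prop := f ≫ ε[Y] = ε[X]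

/-- A morphism is deterministic if it can be copied. (Mathlib's `Deterministic` also asks that it
be total; here the two conditions are kept apart.) -/
def IsDeterministic {X Y : C} (f : X ⟶ Y) : Prop := f ≫ Δ[Y] = Δ[X] ≫ (f ⊗ₘ f)

/-- The first projection. -/
def proj₁ (X Y : C) : X ⊗ Y ⟶ X := (X ◁ ε[Y]) ≫ (ρ_ X).hom

/-- The second projection. -/
def proj₂ (X Y : C) : X ⊗ Y ⟶ Y := (ε[X] ▷ Y) ≫ (λ_ Y).hom

/-- `φ(f)`: run `f` while keeping a copy of its input. -/
def graph {X Y : C} (f : X ⟶ Y) : X ⟶ X ⊗ Y := Δ[X] ≫ (X ◁ f)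

/-- The conditional composition `f ◁ g = φ(f) ; φ(g) ; π₂` of `f : X ⟶ A` with `g : X ⊗ A ⟶ B`:
run `f`, keeping copies of its input and of its output, feed these copies to `g`, and return the
outputs of `f` and of `g`. -/
def condComp {X A B : C} (f : X ⟶ A) (g : X ⊗ A ⟶ B) : X ⟶ A ⊗ B :=
  graph f ≫ graph g ≫ (α_ X A B).hom ≫ proj₂ X (A ⊗ B)

/-- Conditional composition `d ◁ g` in the case `A = I`, with the unit wire removed: here
`d : X ⟶ I` and `g : X ⟶ Y`, and `X ⊗ I`, `I ⊗ Y` are identified with `X`, `Y` through the unitors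
of the monoidal category. -/
def condCompUnit {X Y : C} (d : X ⟶ 𝟙_ C) (g : X ⟶ Y) : X ⟶ Y :=
  condComp d ((ρ_ X).hom ≫ g) ≫ (λ_ Y).hom

/-- `f`-almost sure equality of `g₁` and `g₂`. -/
def AlmostSurelyEq {X A B : C} (f : X ⟶ A) (g₁ g₂ : X ⊗ A ⟶ B) : Prop :=
  condComp f g₁ = condComp f g₂

/-- `n` is a normalisation of `f` if `f = (f ; ε) ◁ n`. -/
def IsNormalisation {X Y : C} (f n : X ⟶ Y) : Prop :=
  f = condCompUnit (f ≫ ε[Y]) n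

/-- The tensor of two states `x : I ⟶ X` and `y : I ⟶ Y`, as a state of `X ⊗ Y`. -/
def tensorState {X Y : C} (x : 𝟙_ C ⟶ X) (y : 𝟙_ C ⟶ Y) : 𝟙_ C ⟶ X ⊗ Y :=
  (λ_ (𝟙_ C)).inv ≫ (x ⊗ₘ y)

theorem isDeterministic_id (X : C) : IsDeterministic (𝟙 X) := by
  simp [IsDeterministic]

theorem isDeterministic_tensorState {X Y : C} {x : 𝟙_ C ⟶ X} {y : 𝟙_ C ⟶ Y}
    (hx : IsDeterministic x) (hy : IsDeterministic y) : IsDeterministic (tensorState x y) := by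
  unfold IsDeterministic at *
  have h1 : tensorμ (𝟙_ C) (𝟙_ C) (𝟙_ C) (𝟙_ C) = 𝟙 _ := by
    have : (β_ (𝟙_ C) (𝟙_ C)).hom = 𝟙 _ := by
      rw [braiding_tensorUnit_left]
      monoidal
    rw [tensorμ, this]
    monoidal
  have h2 := tensorμ_natural x x y y
  rw [tensorState, CopyDiscardCategory.copy_tensor, Category.assoc, tensorHom_comp_tensorHom_assoc,
    hx, hy, ← tensorHom_comp_tensorHom_assoc, h2, h1, CopyDiscardCategory.copy_unit,
    Category.id_comp, ← tensorHom_comp_tensorHom]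

end General

/-- Conditionals: every `f : X ⟶ Y ⊗ Z` factors through its marginal on `Y`. -/
class HasConditionals (C : Type u) [Category.{v} C] [MonoidalCategory C] [CopyDiscardCategory C] :
    Prop where
  exists_conditional : ∀ {X Y Z : C} (f : X ⟶ Y ⊗ Z),
    ∃ c : X ⊗ Y ⟶ Z, f = condComp (f ≫ proj₁ Y Z) c

end CopyDiscard

open CopyDiscard

/-! ## The category of processes with exact observations -/

/-- The objects of `exact(C)` are the objects of `C`. -/
structure Exact (C : Type u) where
  /-- the underlying object of `C` -/
  as : C

namespace Exact

section Construction

variable (C : Type u) [Category.{v} C] [MonoidalCategory C] [CopyDiscardCategory C]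

/-- Formal expressions built, with sequential composition and tensor, from the morphisms of `C` and
one generator `x° : X ⟶ I` for each deterministic state `x : I ⟶ X` of `C`. -/
inductive Term : C → C → Type (max u v)
  | base {X Y : C} (f : X ⟶ Y) : Term X Y
  | obs {X : C} (x : 𝟙_ C ⟶ X) (hx : IsDeterministic x) : Term X (𝟙_ C)
  | comp {X Y Z : C} (f : Term X Y) (g : Term Y Z) : Term X Z
  | tensor {X Y X' Y' : C} (f : Term X Y) (g : Term X' Y') : Term (X ⊗ X') (Y ⊗ Y')

/-- The least congruence on formal expressions which makes them a symmetric monoidal category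
that receives a strict symmetric monoidal functor from `C` (its structure morphisms, copies and
discards being those of `C`), and which satisfies the axioms for the generators `x°`. -/
inductive Rel : {X Y : C} → Term C X Y → Term C X Y → Prop
  /- equivalence relation -/
  | refl {X Y : C} (f : Term C X Y) : Rel f f
  | symm {X Y : C} {f g : Term C X Y} : Rel f g → Rel g f
  | trans {X Y : C} {f g h : Term C X Y} : Rel f g → Rel g h → Rel f h
  /- congruence -/
  | comp_congr {X Y Z : C} {f f' : Term C X Y} {g g' : Term C Y Z} :
      Rel f f' → Rel g g' → Rel (f.comp g) (f'.comp g')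
  | tensor_congr {X Y X' Y' : C} {f f' : Term C X Y} {g g' : Term C X' Y'} :
      Rel f f' → Rel g g' → Rel (f.tensor g) (f'.tensor g')
  /- category axioms -/
  | id_comp {X Y : C} (f : Term C X Y) : Rel ((Term.base (𝟙 X)).comp f) f
  | comp_id {X Y : C} (f : Term C X Y) : Rel (f.comp (Term.base (𝟙 Y))) f
  | assoc {X Y Z W : C} (f : Term C X Y) (g : Term C Y Z) (h : Term C Z W) :
      Rel ((f.comp g).comp h) (f.comp (g.comp h))
  /- the inclusion of `C` preserves composition and tensor -/
  | base_comp {X Y Z : C} (f : X ⟶ Y) (g : Y ⟶ Z) :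
      Rel (Term.base (f ≫ g)) ((Term.base f).comp (Term.base g))
  | base_tensor {X Y X' Y' : C} (f : X ⟶ Y) (g : X' ⟶ Y') :
      Rel (Term.base (f ⊗ₘ g)) ((Term.base f).tensor (Term.base g))
  /- the tensor preserves composition -/
  | interchange {X Y Z X' Y' Z' : C} (f : Term C X Y) (g : Term C Y Z)
      (f' : Term C X' Y') (g' : Term C Y' Z') :
      Rel ((f.tensor f').comp (g.tensor g')) ((f.comp g).tensor (f'.comp g'))
  /- naturality of the associators, unitors and braidings of `C` -/
  | associator_naturality {X Y X' Y' X'' Y'' : C}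
      (f : Term C X Y) (f' : Term C X' Y') (f'' : Term C X'' Y'') :
      Rel (((f.tensor f').tensor f'').comp (Term.base (α_ Y Y' Y'').hom))
        ((Term.base (α_ X X' X'').hom).comp (f.tensor (f'.tensor f'')))
  | leftUnitor_naturality {X Y : C} (f : Term C X Y) :
      Rel (((Term.base (𝟙 (𝟙_ C))).tensor f).comp (Term.base (λ_ Y).hom))
        ((Term.base (λ_ X).hom).comp f)
  | rightUnitor_naturality {X Y : C} (f : Term C X Y) :
      Rel ((f.tensor (Term.base (𝟙 (𝟙_ C)))).comp (Term.base (ρ_ Y).hom))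
        ((Term.base (ρ_ X).hom).comp f)
  | braiding_naturality {X Y X' Y' : C} (f : Term C X Y) (f' : Term C X' Y') :
      Rel ((f.tensor f').comp (Term.base (β_ Y Y').hom))
        ((Term.base (β_ X X').hom).comp (f'.tensor f))
  /- compatibility of observations with the tensor: `(x ⊗ y)° = x° ⊗ y°` and `id_I° = id_I` -/
  | obs_tensor {X Y : C} (x : 𝟙_ C ⟶ X) (hx : IsDeterministic x) (y : 𝟙_ C ⟶ Y)
      (hy : IsDeterministic y) :
      Rel (Term.obs (tensorState x y) (isDeterministic_tensorState hx hy))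
        (((Term.obs x hx).tensor (Term.obs y hy)).comp (Term.base (λ_ (𝟙_ C)).hom))
  | obs_id : Rel (Term.obs (𝟙 (𝟙_ C)) (isDeterministic_id (𝟙_ C))) (Term.base (𝟙 (𝟙_ C)))
  /- the observation axiom: `x° ◁ id = x° ; x` -/
  | obs_comp {X : C} (x : 𝟙_ C ⟶ X) (hx : IsDeterministic x) :
      Rel (((Term.base Δ[X]).comp ((Term.obs x hx).tensor (Term.base (𝟙 X)))).comp
          (Term.base (λ_ X).hom))
        ((Term.obs x hx).comp (Term.base x))

/-- Formal expressions up to the congruence. -/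
instance termSetoid (X Y : C) : Setoid (Term C X Y) where
  r := Rel C
  iseqv := ⟨Rel.refl, Rel.symm, Rel.trans⟩

variable {C}

instance : Category.{max u v} (Exact C) where
  Hom X Y := Quotient (termSetoid C X.as Y.as)
  id X := Quotient.mk _ (Term.base (𝟙 X.as))
  comp := Quotient.map₂ Term.comp (fun _ _ hf _ _ hg => Rel.comp_congr hf hg)
  id_comp := by
    rintro X Y ⟨f⟩
    exact Quotient.sound (Rel.id_comp f)
  comp_id := by
    rintro X Y ⟨f⟩
    exact Quotient.sound (Rel.comp_id f)
  assoc := by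
    rintro W X Y Z ⟨f⟩ ⟨g⟩ ⟨h⟩
    exact Quotient.sound (Rel.assoc f g h)

/-- A morphism of `C`, regarded as a morphism of `exact(C)`. -/
def ofBase {X Y : C} (f : X ⟶ Y) : Exact.mk X ⟶ Exact.mk Y :=
  Quotient.mk (termSetoid C X Y) (Term.base f)

/-- The observation `x° : X ⟶ I` of a deterministic state `x : I ⟶ X` of `C`. -/
def obs {X : C} (x : 𝟙_ C ⟶ X) (hx : IsDeterministic x) : Exact.mk X ⟶ Exact.mk (𝟙_ C) :=
  Quotient.mk (termSetoid C X (𝟙_ C)) (Term.obs x hx)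

theorem ofBase_id (X : C) : ofBase (𝟙 X) = 𝟙 (Exact.mk X) := rfl

theorem ofBase_comp {X Y Z : C} (f : X ⟶ Y) (g : Y ⟶ Z) :
    ofBase (f ≫ g) = ofBase f ≫ ofBase g :=
  Quotient.sound (Rel.base_comp f g)

/-- The tensor product of morphisms of `exact(C)`. -/
def tensorMap {X Y X' Y' : Exact C} (f : X ⟶ Y) (g : X' ⟶ Y') :
    Exact.mk (X.as ⊗ X'.as) ⟶ Exact.mk (Y.as ⊗ Y'.as) :=
  Quotient.map₂ Term.tensor (fun _ _ hf _ _ hg => Rel.tensor_congr hf hg) f g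

theorem ofBase_tensor {X Y X' Y' : C} (f : X ⟶ Y) (g : X' ⟶ Y') :
    ofBase (f ⊗ₘ g) = tensorMap (ofBase f) (ofBase g) :=
  Quotient.sound (Rel.base_tensor f g)

theorem tensorMap_comp {X Y Z X' Y' Z' : Exact C} (f : X ⟶ Y) (g : Y ⟶ Z)
    (f' : X' ⟶ Y') (g' : Y' ⟶ Z') :
    tensorMap f f' ≫ tensorMap g g' = tensorMap (f ≫ g) (f' ≫ g') := by
  obtain ⟨f⟩ := f
  obtain ⟨g⟩ := g
  obtain ⟨f'⟩ := f'
  obtain ⟨g'⟩ := g'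
  exact Quotient.sound (Rel.interchange f g f' g')

theorem tensorMap_id (X Y : Exact C) :
    tensorMap (𝟙 X) (𝟙 Y) = 𝟙 (Exact.mk (X.as ⊗ Y.as)) := by
  have h := ofBase_tensor (𝟙 X.as) (𝟙 Y.as)
  rw [id_tensorHom_id] at h
  exact h.symm

/-- An isomorphism of `C`, regarded as an isomorphism of `exact(C)`. -/
def ofBaseIso {X Y : C} (e : X ≅ Y) : Exact.mk X ≅ Exact.mk Y where
  hom := ofBase e.hom
  inv := ofBase e.inv
  hom_inv_id := by rw [← ofBase_comp, e.hom_inv_id, ofBase_id]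
  inv_hom_id := by rw [← ofBase_comp, e.inv_hom_id, ofBase_id]

instance : MonoidalCategoryStruct (Exact C) where
  tensorObj X Y := Exact.mk (X.as ⊗ Y.as)
  tensorHom f g := tensorMap f g
  whiskerLeft X _ _ f := tensorMap (𝟙 X) f
  whiskerRight f Y := tensorMap f (𝟙 Y)
  tensorUnit := Exact.mk (𝟙_ C)
  associator X Y Z := ofBaseIso (α_ X.as Y.as Z.as)
  leftUnitor X := ofBaseIso (λ_ X.as)
  rightUnitor X := ofBaseIso (ρ_ X.as)

instance : MonoidalCategory (Exact C) := MonoidalCategory.ofTensorHom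
  (id_tensorHom_id := fun X Y => tensorMap_id X Y)
  (tensorHom_comp_tensorHom := fun f g f' g' => tensorMap_comp f f' g g')
  (associator_naturality := by
    rintro X X' X'' Y Y' Y'' ⟨f⟩ ⟨g⟩ ⟨h⟩
    exact Quotient.sound (Rel.associator_naturality f g h))
  (leftUnitor_naturality := by
    rintro X Y ⟨f⟩
    exact Quotient.sound (Rel.leftUnitor_naturality f))
  (rightUnitor_naturality := by
    rintro X Y ⟨f⟩
    exact Quotient.sound (Rel.rightUnitor_naturality f))
  (pentagon := fun W X Y Z => by
    have h := congrArg ofBase (MonoidalCategory.pentagon W.as X.as Y.as Z.as)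
    rw [← tensorHom_id, ← id_tensorHom] at h
    simp only [ofBase_comp, ofBase_tensor] at h
    exact h)
  (triangle := fun X Y => by
    have h := congrArg ofBase (MonoidalCategory.triangle X.as Y.as)
    rw [← tensorHom_id, ← id_tensorHom] at h
    simp only [ofBase_comp, ofBase_tensor] at h
    exact h)

theorem ofBase_whiskerLeft (X : C) {Y Z : C} (f : Y ⟶ Z) :
    ofBase (X ◁ f) = Exact.mk X ◁ ofBase f := by
  rw [← id_tensorHom]
  exact ofBase_tensor (𝟙 X) f

theorem ofBase_whiskerRight {X Y : C} (f : X ⟶ Y) (Z : C) :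
    ofBase (f ▷ Z) = ofBase f ▷ Exact.mk Z := by
  rw [← tensorHom_id]
  exact ofBase_tensor f (𝟙 Z)

theorem ofBase_tensorHom {X Y X' Y' : C} (f : X ⟶ Y) (g : X' ⟶ Y') :
    ofBase (f ⊗ₘ g) = ofBase f ⊗ₘ ofBase g :=
  ofBase_tensor f g

theorem tensorHom_braiding {X Y X' Y' : Exact C} (f : X ⟶ Y) (f' : X' ⟶ Y') :
    (f ⊗ₘ f') ≫ ofBase (β_ Y.as Y'.as).hom = ofBase (β_ X.as X'.as).hom ≫ (f' ⊗ₘ f) := by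
  obtain ⟨f⟩ := f
  obtain ⟨f'⟩ := f'
  exact Quotient.sound (Rel.braiding_naturality f f')

instance : SymmetricCategory (Exact C) where
  braiding X Y := ofBaseIso (β_ X.as Y.as)
  braiding_naturality_right X Y Z f := by
    rw [← id_tensorHom, ← tensorHom_id]
    exact tensorHom_braiding (𝟙 X) f
  braiding_naturality_left f Z := by
    rw [← id_tensorHom, ← tensorHom_id]
    exact tensorHom_braiding f (𝟙 Z)
  hexagon_forward X Y Z := by
    have h := congrArg ofBase (BraidedCategory.hexagon_forward X.as Y.as Z.as)
    simp only [ofBase_comp, ofBase_whiskerLeft, ofBase_whiskerRight] at h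
    exact h
  hexagon_reverse X Y Z := by
    have h := congrArg ofBase (BraidedCategory.hexagon_reverse X.as Y.as Z.as)
    simp only [ofBase_comp, ofBase_whiskerLeft, ofBase_whiskerRight] at h
    exact h
  symmetry X Y := by
    have h := congrArg ofBase (SymmetricCategory.symmetry X.as Y.as)
    simp only [ofBase_comp] at h
    exact h

theorem ofBase_tensorμ (X₁ X₂ Y₁ Y₂ : C) :
    ofBase (tensorμ X₁ X₂ Y₁ Y₂) =
      tensorμ (Exact.mk X₁) (Exact.mk X₂) (Exact.mk Y₁) (Exact.mk Y₂) := by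
  simp only [tensorμ, ofBase_comp, ofBase_whiskerLeft, ofBase_whiskerRight]
  rfl

/-- The copy and the discard of an object of `exact(C)` are those of `C`. -/
@[reducible] def comonObj (X : Exact C) : ComonObj X where
  counit := ofBase ε[X.as]
  comul := ofBase Δ[X.as]
  counit_comul := by
    have h := congrArg ofBase (ComonObj.counit_comul X.as)
    simp only [ofBase_comp, ofBase_whiskerRight] at h
    exact h
  comul_counit := by
    have h := congrArg ofBase (ComonObj.comul_counit X.as)
    simp only [ofBase_comp, ofBase_whiskerLeft] at h
    exact h
  comul_assoc := by
    have h := congrArg ofBase (ComonObj.comul_assoc X.as)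
    simp only [ofBase_comp, ofBase_whiskerLeft, ofBase_whiskerRight] at h
    exact h

theorem isCommComonObj (X : Exact C) : @IsCommComonObj _ _ _ _ X (comonObj X) :=
  @IsCommComonObj.mk _ _ _ _ X (comonObj X) <| by
    have h := congrArg ofBase (IsCommComonObj.comul_comm X.as)
    simp only [ofBase_comp] at h
    exact h

instance : CopyDiscardCategory (Exact C) where
  comonObj := comonObj
  isCommComonObj := isCommComonObj
  copy_tensor X Y := by
    have h := congrArg ofBase (CopyDiscardCategory.copy_tensor X.as Y.as)
    simp only [ofBase_comp, ofBase_tensorHom, ofBase_tensorμ] at h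
    exact h
  discard_tensor X Y := by
    have h := congrArg ofBase (CopyDiscardCategory.discard_tensor X.as Y.as)
    simp only [ofBase_comp, ofBase_tensorHom] at h
    exact h
  copy_unit := congrArg ofBase CopyDiscardCategory.copy_unit
  discard_unit := congrArg ofBase CopyDiscardCategory.discard_unit

/-- `f = (h ; z°) ◁ g` is a normal form of the morphism `f : X ⟶ Y` of `exact(C)`: here
`h : X ⟶ Z` and `g : X ⟶ Y` are total and the state `z : I ⟶ Z` of `C` is total and
deterministic. -/
def IsNormalForm {X Y Z : C} (f : Exact.mk X ⟶ Exact.mk Y) (h : Exact.mk X ⟶ Exact.mk Z)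
    (z : 𝟙_ C ⟶ Z) (hz : IsDeterministic z) (g : Exact.mk X ⟶ Exact.mk Y) : Prop :=
  IsTotal h ∧ IsTotal z ∧ IsTotal g ∧ f = condCompUnit (h ≫ obs z hz) g

end Construction

end Exact

/-! Existence: since effects slide past later morphisms, all observations in `f` can be postponed
and tensored into one, so `f` is a base morphism `k : X ⟶ Z ⊗ Y` followed by `z°` on `Z`
(`exists_isObservationOf`). A conditional splits `k` as `h ◁ c`, where `c` reads a copy of the
output of `h`. The other copy meets `z°`, and the observation axiom `z° ◁ id = z° ; z` puts the
state `z` in place of the copy read by `c` (`IsObservationOf.eq_condCompUnit`). Hence `g` is `c`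
with `z` plugged in, and it no longer depends on `h`. Normalisation: if `f = d ◁ g` with `g` total,
discarding the output gives `f ; ε = d`, so `g` is a normalisation. Two normalisations of `f` agree
almost surely because both composites with `f ; ε` equal `f`. -/

namespace CopyDiscard

/-! ### Conditional composition and normalisation in copy-discard categories. -/

section

variable {C : Type u} [Category.{v} C] [MonoidalCategory C] [CopyDiscardCategory C]

/-- Applying an effect to the first output of a conditional composition. -/
theorem condComp_comp_effect {X A B : C} (f : X ⟶ A) (g : X ⊗ A ⟶ B) (e : A ⟶ 𝟙_ C) :
    condComp f g ≫ e ▷ B ≫ (λ_ B).hom =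
      graph f ≫ X ◁ (Δ[A] ≫ e ▷ A ≫ (λ_ A).hom) ≫ g := by
  -- Discarding `X` and applying `e` to `A` form a single effect on `X ⊗ A`.
  have h1 : (α_ X A B).hom ≫ proj₂ X (A ⊗ B) ≫ e ▷ B ≫ (λ_ B).hom =
      ((ε[X] ⊗ₘ e) ≫ (λ_ (𝟙_ C)).hom) ▷ B ≫ (λ_ B).hom := by
    simp only [proj₂, MonoidalCategory.tensorHom_def]
    monoidal
  -- On one of two copies of `X ⊗ A`, that effect cancels the copy of `X` by the counit law; only
  -- the copy of `A` survives.
  have h2 : (CopyDiscardCategory.comonObj (X ⊗ A)).comul ≫ ((ε[X] ⊗ₘ e) ≫ (λ_ (𝟙_ C)).hom) ▷ (X ⊗ A) ≫ (λ_ (X ⊗ A)).hom =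
      X ◁ (Δ[A] ≫ e ▷ A ≫ (λ_ A).hom) := by
    have h3 := tensorμ_natural ε[X] (𝟙 X) e (𝟙 A)
    rw [id_tensorHom_id] at h3
    rw [CopyDiscardCategory.copy_tensor, comp_whiskerRight, ← tensorHom_id (ε[X] ⊗ₘ e)]
    simp only [Category.assoc]
    rw [← reassoc_of% h3, ← leftUnitor_monoidal]
    simp only [tensorHom_comp_tensorHom, tensorHom_id]
    rw [← Category.assoc, ComonObj.counit_comul, Iso.inv_hom_id, id_tensorHom]
  simp only [condComp, Category.assoc]
  rw [h1]
  simp only [graph, Category.assoc]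
  -- The effect slides before `g`, directly after the copy.
  rw [whisker_exchange_assoc, leftUnitor_naturality, reassoc_of% h2]

/-- Copying the unit object is a unitor, so all that remains is to copy the input, apply `d` to one
copy and `g` to the other. -/
theorem condCompUnit_eq {X Y : C} (d : X ⟶ 𝟙_ C) (g : X ⟶ Y) :
    condCompUnit d g = graph d ≫ (ρ_ X).hom ≫ g := by
  have h := condComp_comp_effect d ((ρ_ X).hom ≫ g) (𝟙 (𝟙_ C))
  simpa [condCompUnit, CopyDiscardCategory.copy_unit] using h

/-- Totality turns `g ; ε` into a discard, which cancels the copy of the input. This identifies `d`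
with `f ; ε` in any normal form. -/
theorem condCompUnit_comp_discard {X Y : C} (d : X ⟶ 𝟙_ C) {g : X ⟶ Y} (hg : IsTotal g) :
    condCompUnit d g ≫ ε[Y] = d := by
  rw [condCompUnit_eq, Category.assoc, Category.assoc, hg, graph, Category.assoc,
    ← rightUnitor_naturality, whisker_exchange_assoc, ComonObj.counit_comul_assoc,
    ← unitors_equal, leftUnitor_naturality, Iso.inv_hom_id_assoc]

theorem isNormalisation_of_eq_condCompUnit {X Y : C} {f g : X ⟶ Y} {d : X ⟶ 𝟙_ C}
    (hg : IsTotal g) (h : f = condCompUnit d g) : IsNormalisation f g := by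
  rw [IsNormalisation, show f ≫ ε[Y] = d by rw [h, condCompUnit_comp_discard d hg]]
  exact h

/-- Any two normalisations of a morphism are almost surely equal. -/
theorem IsNormalisation.almostSurelyEq {X Y : C} {f n g : X ⟶ Y}
    (hn : IsNormalisation f n) (hg : IsNormalisation f g) :
    AlmostSurelyEq (f ≫ ε[Y]) ((ρ_ X).hom ≫ n) ((ρ_ X).hom ≫ g) :=
  (cancel_mono (λ_ Y).hom).1 (hn.symm.trans hg)

end

theorem isTotal_of_markov {C : Type u} [Category.{v} C] [MonoidalCategory C] [MarkovCategory C]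
    {X Y : C} (f : X ⟶ Y) : IsTotal f :=
  MarkovCategory.discard_natural f

end CopyDiscard

namespace Exact

/-! ### Gathering observations and computing the normal form in `Exact C`. -/

section

variable {C : Type u} [Category.{v} C] [MonoidalCategory C] [CopyDiscardCategory C]

theorem isTotal_ofBase {X Y : C} {f : X ⟶ Y} (hf : IsTotal f) : IsTotal (ofBase f) :=
  (ofBase_comp f ε[Y]).symm.trans (congrArg ofBase hf)

theorem ofBase_condComp {X A B : C} (f : X ⟶ A) (g : X ⊗ A ⟶ B) :
    ofBase (condComp f g) =
      condComp (X := Exact.mk X) (A := Exact.mk A) (B := Exact.mk B) (ofBase f) (ofBase g) := by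
  simp only [condComp, graph, proj₂, ofBase_comp, ofBase_whiskerLeft, ofBase_whiskerRight]
  rfl

theorem copy_obs {X : C} (x : 𝟙_ C ⟶ X) (hx : IsDeterministic x) :
    Δ[Exact.mk X] ≫ obs x hx ▷ Exact.mk X ≫ (λ_ (Exact.mk X)).hom = obs x hx ≫ ofBase x := by
  rw [← Category.assoc]
  exact Quotient.sound (Rel.obs_comp x hx)

theorem obs_id : obs (𝟙 (𝟙_ C)) (isDeterministic_id (𝟙_ C)) = 𝟙 (𝟙_ (Exact C)) :=
  Quotient.sound Rel.obs_id

theorem obs_tensorState {X Y : C} {x : 𝟙_ C ⟶ X} (hx : IsDeterministic x) {y : 𝟙_ C ⟶ Y}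
    (hy : IsDeterministic y) :
    obs (tensorState x y) (isDeterministic_tensorState hx hy) =
      (obs x hx ⊗ₘ obs y hy) ≫ (λ_ (𝟙_ (Exact C))).hom :=
  Quotient.sound (Rel.obs_tensor x hx y hy)

/-- `f` is obtained from the morphism `k : X ⟶ Z ⊗ Y` of `C` by observing `z` on the output `Z`. -/
def IsObservationOf {X Y Z : C} (f : Exact.mk X ⟶ Exact.mk Y) (k : X ⟶ Z ⊗ Y) (z : 𝟙_ C ⟶ Z)
    (hz : IsDeterministic z) : Prop :=
  f = ofBase k ≫ obs z hz ▷ Exact.mk Y ≫ (λ_ (Exact.mk Y)).hom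

theorem isObservationOf_ofBase {X Y : C} (f : X ⟶ Y) :
    IsObservationOf (ofBase f) (f ≫ (λ_ Y).inv) (𝟙 (𝟙_ C)) (isDeterministic_id _) := by
  rw [IsObservationOf, obs_id, ofBase_comp]
  erw [id_whiskerRight, Category.id_comp, Category.assoc,
    Iso.inv_hom_id (λ_ (Exact.mk Y)), Category.comp_id]

theorem isObservationOf_obs {X : C} (x : 𝟙_ C ⟶ X) (hx : IsDeterministic x) :
    IsObservationOf (obs x hx) (ρ_ X).inv x hx := by
  have h := rightUnitor_naturality (obs x hx)
  have h' : (λ_ (𝟙_ (Exact C))).hom = (ρ_ (𝟙_ (Exact C))).hom := unitors_equal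
  have h2 : obs x hx ▷ 𝟙_ (Exact C) ≫ (λ_ (𝟙_ (Exact C))).hom =
      (ρ_ (Exact.mk X)).hom ≫ obs x hx := by
    rw [h']
    exact h
  exact ((Iso.inv_comp_eq (ρ_ (Exact.mk X))).2 h2).symm

/-- The first observation waits until `l` has run; the tensor axiom for observations then merges the
two. -/
theorem IsObservationOf.comp {X Y W Z Z' : C} {f : Exact.mk X ⟶ Exact.mk Y}
    {g : Exact.mk Y ⟶ Exact.mk W} {k : X ⟶ Z ⊗ Y} {l : Y ⟶ Z' ⊗ W} {z : 𝟙_ C ⟶ Z}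
    {z' : 𝟙_ C ⟶ Z'} {hz : IsDeterministic z} {hz' : IsDeterministic z'}
    (hf : IsObservationOf f k z hz) (hg : IsObservationOf g l z' hz') :
    IsObservationOf (f ≫ g) (k ≫ Z ◁ l ≫ (α_ Z Z' W).inv) (tensorState z z')
      (isDeterministic_tensorState hz hz') := by
  have key : ∀ {X Y W Z Z' : Exact C} (k : X ⟶ Z ⊗ Y) (l : Y ⟶ Z' ⊗ W) (e : Z ⟶ 𝟙_ (Exact C))
      (e' : Z' ⟶ 𝟙_ (Exact C)),
      (k ≫ e ▷ Y ≫ (λ_ Y).hom) ≫ l ≫ e' ▷ W ≫ (λ_ W).hom =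
        (k ≫ Z ◁ l ≫ (α_ Z Z' W).inv) ≫
          ((e ⊗ₘ e') ≫ (λ_ (𝟙_ (Exact C))).hom) ▷ W ≫ (λ_ W).hom := by
    intro X Y W Z Z' k l e e'
    simp only [Category.assoc]
    -- Interchange moves `e` past `l`; the rest is coherence.
    rw [← leftUnitor_naturality_assoc, ← whisker_exchange_assoc, MonoidalCategory.tensorHom_def]
    congr 2
    monoidal
  rw [IsObservationOf] at hf hg ⊢
  rw [hf, hg, obs_tensorState hz hz', ofBase_comp, ofBase_comp, ofBase_whiskerLeft]
  exact key (ofBase k) (ofBase l) (obs z hz) (obs z' hz')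

/-- `tensorμ` brings the observed wires `Z` and `Z'` together, and its naturality carries the two
effects through. -/
theorem IsObservationOf.tensor {X Y Z X' Y' Z' : C} {f : Exact.mk X ⟶ Exact.mk Y}
    {g : Exact.mk X' ⟶ Exact.mk Y'} {k : X ⟶ Z ⊗ Y} {l : X' ⟶ Z' ⊗ Y'} {z : 𝟙_ C ⟶ Z}
    {z' : 𝟙_ C ⟶ Z'} {hz : IsDeterministic z} {hz' : IsDeterministic z'}
    (hf : IsObservationOf f k z hz) (hg : IsObservationOf g l z' hz') :
    IsObservationOf (tensorMap f g) ((k ⊗ₘ l) ≫ tensorμ Z Y Z' Y') (tensorState z z')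
      (isDeterministic_tensorState hz hz') := by
  have key : ∀ {X Y Z X' Y' Z' : Exact C} (k : X ⟶ Z ⊗ Y) (l : X' ⟶ Z' ⊗ Y')
      (e : Z ⟶ 𝟙_ (Exact C)) (e' : Z' ⟶ 𝟙_ (Exact C)),
      (k ≫ e ▷ Y ≫ (λ_ Y).hom) ⊗ₘ (l ≫ e' ▷ Y' ≫ (λ_ Y').hom) =
        ((k ⊗ₘ l) ≫ tensorμ Z Y Z' Y') ≫
          ((e ⊗ₘ e') ≫ (λ_ (𝟙_ (Exact C))).hom) ▷ (Y ⊗ Y') ≫ (λ_ (Y ⊗ Y')).hom := by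
    intro X Y Z X' Y' Z' k l e e'
    have h := tensorμ_natural e (𝟙 Y) e' (𝟙 Y')
    rw [id_tensorHom_id, tensorHom_id, tensorHom_id, tensorHom_id] at h
    simp only [Category.assoc, comp_whiskerRight]
    rw [← reassoc_of% h, ← leftUnitor_monoidal, tensorHom_comp_tensorHom,
      tensorHom_comp_tensorHom]
  rw [IsObservationOf] at hf hg ⊢
  rw [hf, hg, obs_tensorState hz hz', ofBase_comp, ofBase_tensorHom, ofBase_tensorμ]
  exact key (ofBase k) (ofBase l) (obs z hz) (obs z' hz')

/-- All observations in a morphism of `exact(C)` can be gathered into a single final one. -/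
theorem exists_isObservationOf {X Y : C} (f : Exact.mk X ⟶ Exact.mk Y) :
    ∃ (Z : C) (k : X ⟶ Z ⊗ Y) (z : 𝟙_ C ⟶ Z) (hz : IsDeterministic z),
      IsObservationOf f k z hz := by
  -- Induction on a representative suffices: the claim concerns only its class, so nothing has to be
  -- checked against `Rel`.
  suffices key : ∀ {X Y : C} (t : Term C X Y), ∃ (Z : C) (k : X ⟶ Z ⊗ Y) (z : 𝟙_ C ⟶ Z)
      (hz : IsDeterministic z), IsObservationOf (Quotient.mk (termSetoid C X Y) t) k z hz by
    obtain ⟨t⟩ := f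
    exact key t
  intro X Y t
  induction t with
  | base f => exact ⟨_, _, _, _, isObservationOf_ofBase f⟩
  | obs x hx => exact ⟨_, _, _, _, isObservationOf_obs x hx⟩
  | comp f g hf hg =>
    obtain ⟨_, _, _, _, hf⟩ := hf
    obtain ⟨_, _, _, _, hg⟩ := hg
    exact ⟨_, _, _, _, hf.comp hg⟩
  | tensor f g hf hg =>
    obtain ⟨_, _, _, _, hf⟩ := hf
    obtain ⟨_, _, _, _, hg⟩ := hg
    exact ⟨_, _, _, _, hf.tensor hg⟩

/-- Observing `z` after a conditional composition `h ◁ c` amounts to observing `z` after `h` and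
then feeding the state `z` to `c`. -/
theorem IsObservationOf.eq_condCompUnit {X Y Z : C} {f : Exact.mk X ⟶ Exact.mk Y} {h : X ⟶ Z}
    {c : X ⊗ Z ⟶ Y} {z : 𝟙_ C ⟶ Z} {hz : IsDeterministic z}
    (hf : IsObservationOf f (condComp h c) z hz) :
    f = condCompUnit (ofBase h ≫ obs z hz) (ofBase ((ρ_ X).inv ≫ X ◁ z ≫ c)) := by
  have e : ofBase ((ρ_ X).inv ≫ X ◁ z ≫ c) =
      (ρ_ (Exact.mk X)).inv ≫ Exact.mk X ◁ ofBase z ≫ ofBase c := by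
    rw [ofBase_comp, ofBase_comp, ofBase_whiskerLeft]
    rfl
  rw [IsObservationOf, ofBase_condComp] at hf
  refine hf.trans ((condComp_comp_effect _ _ _).trans ?_)
  -- The observation axiom acts here: copying `Z` and observing one copy becomes observing `Z` and
  -- preparing `z` afresh.
  rw [copy_obs, condCompUnit_eq, e, Iso.hom_inv_id_assoc]
  simp only [graph, Category.assoc, whiskerLeft_comp]

end

end Exact

/-- Every morphism `f` of `exact(C)` has a normal form `f = (h ; z°) ◁ g`, with `h`, `z`, `g` in the
base Markov category; and in every normal form of `f` (with `h`, `g` in `exact(C)`), `g` is a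
normalisation of `f`, almost surely equal to any other one. -/
theorem theorem5p3 {C : Type u} [Category.{v} C] [MonoidalCategory C] [MarkovCategory C]
    [CopyDiscard.HasConditionals C] {X Y : C} (f : Exact.mk X ⟶ Exact.mk Y) :
    (∃ (Z : C) (h : X ⟶ Z) (z : 𝟙_ C ⟶ Z) (hz : CopyDiscard.IsDeterministic z) (g : X ⟶ Y),
      Exact.IsNormalForm f (Exact.ofBase h) z hz (Exact.ofBase g)) ∧
    (∀ (Z : C) (h : Exact.mk X ⟶ Exact.mk Z) (z : 𝟙_ C ⟶ Z) (hz : CopyDiscard.IsDeterministic z)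
      (g : Exact.mk X ⟶ Exact.mk Y), Exact.IsNormalForm f h z hz g →
      CopyDiscard.IsNormalisation f g ∧
      ∀ n : Exact.mk X ⟶ Exact.mk Y, CopyDiscard.IsNormalisation f n →
        CopyDiscard.AlmostSurelyEq (f ≫ ε[Exact.mk Y])
          ((ρ_ (Exact.mk X)).hom ≫ n) ((ρ_ (Exact.mk X)).hom ≫ g)) := by
  refine ⟨?_, fun Z h z hz g hf => ?_⟩
  · obtain ⟨Z, k, z, hz, hk⟩ := Exact.exists_isObservationOf f
    -- Condition on the observed output `Z`.
    obtain ⟨c, hc⟩ := HasConditionals.exists_conditional k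
    rw [hc] at hk
    -- The placeholders are the marginal `k ≫ proj₁ Z Y` and the conditional at `z`, namely `(ρ_
    -- X).inv ≫ X ◁ z ≫ c`.
    exact ⟨Z, _, z, hz, _, Exact.isTotal_ofBase (isTotal_of_markov _), isTotal_of_markov z,
      Exact.isTotal_ofBase (isTotal_of_markov _), hk.eq_condCompUnit⟩
  · have hg := isNormalisation_of_eq_condCompUnit hf.2.2.1 hf.2.2.2
    exact ⟨hg, fun n hn => hn.almostSurelyEq hg⟩
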